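/- **Model.** $n\ge 1$ processes $p_0,\dots,p_{n-1}$ form an oriented ring: the clockwise neighbour of $p_j$ is $p_{j+1}$ and its counter-clockwise neighbour is $p_{j-1}$ (indices modulo $n$). The processes have pairwise distinct identifiers, arbitrarily chosen from $\mathbb N=\{0,1,2,\dots\}$; $\mathsf{ID}_{\min}$ is the smallest of them. All processes run the same deterministic algorithm (a state machine), whose only inputs are the process's own identifier and an upper bound $U\ge n$ on the size of the ring. The system is asynchronous and content-oblivious: messages carry no content, only the direction from which they arrive; they are never lost or created, each is delivered after a finite but unbounded delay, and delivered messages are buffered until the process chooses to receive them. A *quiescently terminating leader election algorithm* is one for which, in every execution, every process eventually enters a final state Leader or Non-Leader (which it never leaves), exactly one process ends in the state Leader, and once the last process has entered its final state there are no messages in transit (sent but not received). **Theorem.** There is a quiescently terminating leader election algorithm for oriented rings in this (non-uniform) setting, and a constant $C$, such that for all $1\le n\le U$, every assignment of distinct identifiers and every execution, each process sends at most $C\,U\,(1+\lfloor\log_2 \mathsf{ID}_{\min}\rfloor)$ clockwise messages and at most $C\,(1+\lfloor\log_2 \mathsf{ID}_{\min}\rfloor)$ counter-clockwise messages, and at most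 $C\,n\,U\,(1+\lfloor\log_2 \mathsf{ID}_{\min}\rfloor)$ messages are sent in total (with $\lfloor\log_2 0\rfloor$ read as $0$). That is, each process sends $O(U\log \mathsf{ID}_{\min})$ clockwise and $O(\log \mathsf{ID}_{\min})$ counter-clockwise messages, for $O(n\cdot U\cdot\log \mathsf{ID}_{\min})$ messages in total. -/

import Mathlib

namespace PulseRing

/-- The two directions of travel on an oriented ring. A clockwise message is sent on port `0` and
received on port `1`; a counter-clockwise message is sent on port `1` and received on port `0`. -/
inductive Dir
  | cw
  | ccw
  deriving DecidableEq

/-- The two possible verdicts of a process. -/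
inductive Verdict
  | leader
  | nonLeader

/-- What a local state asks for: to receive one message travelling in some direction of the set `D`
(other messages stay buffered), or to stop with a verdict. -/
inductive Mode
  | listen (D : Set Dir)
  | final (v : Verdict)

/-- A deterministic content-oblivious algorithm: every process runs the same (possibly infinite)
state machine. The only inputs of a process are the known upper bound `U` on the size of the ring
and its own identifier, and a message carries nothing beyond the port on which it arrives.
A process performs its non-blocking actions at once: on starting, and on receiving a message,
it changes its local state and sends `out d` messages in each direction `d`. -/
structure Algorithm where
  State : Type
  /-- `init U ID`: the first local state, and the messages sent on starting. -/
  init : ℕ → ℕ → State × (Dir → ℕ)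
  mode : State → Mode
  /-- `react s d`: the effect of receiving, in the local state `s`, a message travelling in the
  direction `d`. (It is never used in a final state, or if `s` does not listen to `d`.) -/
  react : State → Dir → State × (Dir → ℕ)

/-- The process that is reached from the process `i` in the direction `d`. -/
def neighbour {n : ℕ} [NeZero n] (i : Fin n) : Dir → Fin n
  | .cw => i + 1
  | .ccw => i - 1

/-- A global configuration of a ring of `n` processes. -/
structure Config (A : Algorithm) (n : ℕ) where
  /-- The local state of each process; `none` if the process has not started yet. -/
  loc : Fin n → Option A.State
  /-- `transit i d`: the number of messages travelling in the direction `d` that have been sent to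
  the process `i` and that it has not received yet (in the channel or in its buffer). -/
  transit : Fin n → Dir → ℕ
  /-- `sent i d`: how many messages the process `i` has sent so far in the direction `d`. -/
  sent : Fin n → Dir → ℕ

/-- No process has started and no message has been sent. -/
def Config.initial (A : Algorithm) (n : ℕ) : Config A n where
  loc _ := none
  transit _ _ := 0
  sent _ _ := 0

/-- The process `i` enters the local state `r.1` and sends `r.2 d` messages in each
direction `d`. -/
def Config.act {A : Algorithm} {n : ℕ} [NeZero n] (c : Config A n) (i : Fin n)
    (r : A.State × (Dir → ℕ)) : Config A n where
  loc := Function.update c.loc i (some r.1)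
  transit j d := c.transit j d + if j = neighbour i d then r.2 d else 0
  sent j d := c.sent j d + if j = i then r.2 d else 0

/-- One message travelling in the direction `d` is removed from those on their way to `i`. -/
def Config.consume {A : Algorithm} {n : ℕ} (c : Config A n) (i : Fin n) (d : Dir) :
    Config A n where
  loc := c.loc
  transit j e := if j = i ∧ e = d then c.transit j e - 1 else c.transit j e
  sent := c.sent

/-- The events: a process starts, or it receives a message travelling in a given direction. -/
inductive Event (n : ℕ)
  | start (i : Fin n)
  | receive (i : Fin n) (d : Dir)

/-- `Step U ident c e c'`: in the configuration `c` the event `e` can happen, and it leads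
to `c'`. A process in a final state takes part in no event. -/
inductive Step {A : Algorithm} {n : ℕ} [NeZero n] (U : ℕ) (ident : Fin n → ℕ)
    (c : Config A n) : Event n → Config A n → Prop
  | start (i : Fin n) (h : c.loc i = none) :
      Step U ident c (.start i) (c.act i (A.init U (ident i)))
  | receive (i : Fin n) (d : Dir) (s : A.State) (D : Set Dir) (h : c.loc i = some s)
      (hs : A.mode s = .listen D) (hd : d ∈ D) (ht : 0 < c.transit i d) :
      Step U ident c (.receive i d) ((c.consume i d).act i (A.react s d))

/-- `c` is the sequence of configurations of an asynchronous execution, in which at time `t` the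
event `e t` happens (`none`: nothing happens). Nothing but fairness restricts the order of the
events: an event that stays possible forever from some time on happens eventually, so that all
delays are finite but unbounded. -/
structure IsExecution {A : Algorithm} {n : ℕ} [NeZero n] (U : ℕ) (ident : Fin n → ℕ)
    (c : ℕ → Config A n) (e : ℕ → Option (Event n)) : Prop where
  initial : c 0 = Config.initial A n
  idle : ∀ t, e t = none → c (t + 1) = c t
  step : ∀ t a, e t = some a → Step U ident (c t) a (c (t + 1))
  fair : ∀ a t, (∀ s ≥ t, ∃ c', Step U ident (c s) a c') → ∃ s ≥ t, e s = some a

/-- The verdict of the process `i`, once it is in a final state. -/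
def Config.verdict {A : Algorithm} {n : ℕ} (c : Config A n) (i : Fin n) : Option Verdict :=
  match c.loc i with
  | none => none
  | some s =>
    match A.mode s with
    | .listen _ => none
    | .final v => some v

/-- All processes are in a final state. -/
def Config.Terminated {A : Algorithm} {n : ℕ} (c : Config A n) : Prop :=
  ∀ i, ∃ v, c.verdict i = some v

/-- The algorithm `A`, given an upper bound `U` on the size of the ring, is a quiescently
terminating leader election algorithm on oriented rings with unique identifiers. (Final states
are never left, so that verdicts are irrevocable.) -/
def IsQuiescentLeaderElection (A : Algorithm) : Prop :=
  ∀ (U n : ℕ) [NeZero n], n ≤ U → ∀ ident : Fin n → ℕ, Function.Injective ident →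
    ∀ (c : ℕ → Config A n) (e : ℕ → Option (Event n)), IsExecution U ident c e →
      (∃ t, (c t).Terminated) ∧
      ∀ t, (c t).Terminated →
        (∃! i, (c t).verdict i = some .leader) ∧ ∀ i d, (c t).transit i d = 0

end PulseRing

namespace PulseRing

/-! Election is reduced to computing disjunctions round by round. In `election`, candidates reveal
their codes bit by bit, and those whose bit differs from the disjunction drop out. The first
disjunction equal to 1 comes in round L, the least binary size of an identifier. Survivors of that
round have size L, so everyone knows that after 2L + 1 rounds whole codes have been compared, and
distinct identifiers leave one candidate (`election.existsUnique_candidate`).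

A simulated round costs each process N = U clockwise pulses, plus one counter-clockwise pulse if the
disjunction is 1. A process with bit 1 withholds its pulses, so an unreleased process at clockwise
distance d from it sends at most d < n ≤ N of them and cannot mistake the round for an all-zero one
(`Inv.sent_lt`). Conversely, no pulse of a later round releases a process that still has pulses to
send in an all-zero round (`Inv.sent_ccw_le`). Processes may be in different rounds, so the
invariant uses cumulative counts, which are determined by the local state and the round.

These counts are bounded, hence only finitely many events occur. A blocked configuration is
terminated (`Inv.terminated_of_blocked`), and in a terminated one sent and received counts agree on
every link, which is quiescence. The cost is that of 2L + 1 rounds, where L is the size of the least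
identifier. -/

/-- A synchronous protocol in which, in each round, every process contributes one bit and every
process learns the disjunction of all the bits. -/
structure OrProtocol where
  State : Type
  init : ℕ → State
  bit : State → Bool
  next : State → Bool → State
  verdict : State → Option Verdict

/-! ### Simulation of synchronous rounds by pulses -/

namespace OrProtocol

variable (P : OrProtocol)

/-- The part of a round that a process is in: it has contributed `0` and waits for news, it has
contributed `1` and waits for news, or it knows that the disjunction is `1`. -/
inductive Stage
  | zero
  | one
  | drain
  deriving DecidableEq

/-- The local state of the asynchronous simulation: the number of clockwise messages per round, the
simulated state, the part of the round, and the number of clockwise messages received in it. -/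
structure SimState where
  size : ℕ
  state : P.State
  stage : Stage
  count : ℕ

/-- The messages to send: `a` clockwise and `b` counter-clockwise ones. -/
def pulses (a b : ℕ) : Dir → ℕ
  | .cw => a
  | .ccw => b

@[simp] lemma pulses_cw (a b : ℕ) : pulses a b .cw = a := rfl
@[simp] lemma pulses_ccw (a b : ℕ) : pulses a b .ccw = b := rfl

/-- Begin a round in the simulated state `p`, or stop. -/
def enter (N : ℕ) (p : P.State) : P.SimState × (Dir → ℕ) :=
  match P.verdict p with
  | some _ => (⟨N, p, .drain, 0⟩, pulses 0 0)
  | none => if P.bit p then (⟨N, p, .one, 0⟩, pulses 0 1) else (⟨N, p, .zero, 0⟩, pulses 1 0)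

/-- The reaction to a message. -/
def react (s : P.SimState) : Dir → P.SimState × (Dir → ℕ)
  | .cw =>
    -- A process that completes the round learned that the disjunction is 1 exactly if it was
    -- released.
    if s.count + 1 = s.size then P.enter s.size (P.next s.state (decide (s.stage = .drain)))
    else ({ s with count := s.count + 1 }, pulses (if s.stage = .zero then 1 else 0) 0)
  | .ccw =>
    ({ s with stage := .drain },
      -- A process with bit 0 has already sent `count + 1` pulses and forwards the release; one with
      -- bit 1 sent its counter-clockwise pulse on entering, so it absorbs this one.
      if s.stage = .zero then pulses (s.size - (s.count + 1)) 1 else pulses s.size 0)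

/-- The directions in which a process listens. -/
def listens (s : P.SimState) : Set Dir :=
  match s.stage with
  -- Once all `size` pulses are sent in this stage, the disjunction must be 0; a counter-clockwise
  -- pulse then belongs to a later round and stays buffered.
  | .zero => {d | d = .cw ∨ s.count + 1 < s.size}
  | .one => {.ccw}
  | .drain => {.cw}

/-- The content-oblivious algorithm that simulates `P`. In each round every process sends and
receives `U` clockwise messages. If all bits are `0`, it sends them one at a time, waiting for one
message after each. A process with the bit `1` blocks this flow and sends a counter-clockwise
message instead, which releases everyone. -/
def algorithm : Algorithm where
  State := P.SimState
  init U x := P.enter U (P.init x)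
  mode s := match P.verdict s.state with
    | some v => .final v
    | none => .listen (P.listens s)
  react := P.react

/-! ### Cumulative counts of a single process -/

variable {P} {n : ℕ} (ident : Fin n → ℕ)

variable (P) in
/-- The synchronous run. -/
def run : ℕ → Fin n → P.State
  | 0, i => P.init (ident i)
  | k + 1, i => P.next (run k i) (decide (∃ j, P.bit (run k j) = true))

variable (P) in
/-- The disjunction of the bits in the round `k`. -/
def disj (k : ℕ) : Bool := decide (∃ j, P.bit (P.run ident k j) = true)

variable (P) in
/-- The number of rounds before the round `k` in which the disjunction is `1`. -/
def ones : ℕ → ℕ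
  | 0 => 0
  | k + 1 => ones k + if P.disj ident k = true then 1 else 0

lemma run_succ (k : ℕ) (i : Fin n) :
    P.run ident (k + 1) i = P.next (P.run ident k i) (P.disj ident k) := rfl

lemma disj_of_bit {k : ℕ} {i : Fin n} (h : P.bit (P.run ident k i) = true) :
    P.disj ident k = true := by
  simp only [disj, decide_eq_true_eq]; exact ⟨i, h⟩

lemma ones_succ_of_disj {k : ℕ} (h : P.disj ident k = true) :
    P.ones ident (k + 1) = P.ones ident k + 1 := by simp [ones, h]

lemma ones_succ_of_not_disj {k : ℕ} (h : P.disj ident k = false) :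
    P.ones ident (k + 1) = P.ones ident k := by simp [ones, h]

lemma ones_mono : Monotone (P.ones ident) :=
  monotone_nat_of_le_succ fun k => by simp [ones]

lemma ones_le (k : ℕ) : P.ones ident k ≤ k := by
  induction k with
  | zero => simp [ones]
  | succ k ih => simp only [ones]; split_ifs <;> omega

variable (P) in
/-- In the synchronous run, all processes stop exactly after `T` rounds. -/
def StopsAt (T : ℕ) : Prop :=
  ∀ i, (∀ k < T, P.verdict (P.run ident k i) = none) ∧ P.verdict (P.run ident T i) ≠ none

variable (P) in
/-- The possible local states of the process `i` in the round `k`, with the numbers of clockwise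
messages it has sent and received, and of counter-clockwise messages it has sent and received. -/
inductive Local (N T : ℕ) (i : Fin n) :
    Option P.SimState → ℕ → ℕ → ℕ → ℕ → ℕ → Prop
  | asleep : Local N T i none 0 0 0 0 0
  | zero (k r : ℕ) (hk : k < T) (hr : r < N) (hb : P.bit (P.run ident k i) = false) :
      Local N T i (some ⟨N, P.run ident k i, .zero, r⟩) k (k * N + r + 1) (k * N + r)
        (P.ones ident k) (P.ones ident k)
  | one (k : ℕ) (hk : k < T) (hb : P.bit (P.run ident k i) = true) :
      Local N T i (some ⟨N, P.run ident k i, .one, 0⟩) k (k * N) (k * N)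
        (P.ones ident k + 1) (P.ones ident k)
  | drain (k r : ℕ) (hk : k < T) (hr : r < N) (hw : P.disj ident k = true) :
      Local N T i (some ⟨N, P.run ident k i, .drain, r⟩) k (k * N + N) (k * N + r)
        (P.ones ident k + 1) (P.ones ident k + 1)
  | final : Local N T i (some ⟨N, P.run ident T i, .drain, 0⟩) T (T * N) (T * N)
        (P.ones ident T) (P.ones ident T)

variable {ident} {N T : ℕ}

lemma mul_add_le_of_lt {k m r N : ℕ} (h : m < k) (hr : r ≤ N) : m * N + r ≤ k * N := by
  have : (m + 1) * N ≤ k * N := Nat.mul_le_mul_right N h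
  rw [Nat.add_mul, Nat.one_mul] at this
  omega

lemma ones_add_one_le {k m : ℕ} (h : m < k) (hw : P.disj ident m = true) :
    P.ones ident m + 1 ≤ P.ones ident k := by
  rw [← ones_succ_of_disj ident hw]; exact ones_mono ident h

lemma Local.round_le {i : Fin n} {s k cs cr as ar} (h : P.Local ident N T i s k cs cr as ar) :
    k ≤ T := by cases h <;> omega

lemma Local.cw_le {i : Fin n} {s k cs cr as ar} (h : P.Local ident N T i s k cs cr as ar) :
    cs ≤ T * N ∧ cr ≤ T * N := by
  cases h with
  | asleep => simp
  | zero k r hk hr hb =>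
    have := mul_add_le_of_lt hk (r := r + 1) (N := N) hr
    omega
  | one k hk hb => have := mul_add_le_of_lt hk (r := 0) (N := N) (by omega); omega
  | drain k r hk hr hw =>
    have := mul_add_le_of_lt hk (r := N) (N := N) le_rfl
    omega
  | final => simp

lemma Local.ccw_le {i : Fin n} {s k cs cr as ar} (h : P.Local ident N T i s k cs cr as ar) :
    as ≤ P.ones ident T ∧ ar ≤ P.ones ident T := by
  cases h with
  | asleep => simp
  | zero k r hk hr hb => have := ones_mono (P := P) ident hk.le; omega
  | one k hk hb => have := ones_add_one_le hk (disj_of_bit ident hb); omega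
  | drain k r hk hr hw => have := ones_add_one_le hk hw; omega
  | final => simp

/-- A process with the bit `1` blocks the clockwise flow until it is released. -/
lemma Local.sent_of_bit {i : Fin n} {s m cs cr as ar k}
    (h : P.Local ident N T i s m cs cr as ar) (hb : P.bit (P.run ident k i) = true)
    (har : ar ≤ P.ones ident k) : cs ≤ k * N := by
  have hw := disj_of_bit ident hb
  cases h with
  | asleep => simp
  | zero m r hk hr hb' =>
    rcases lt_trichotomy m k with h | h | h
    · exact mul_add_le_of_lt h (r := r + 1) hr
    · subst h; simp [hb] at hb'
    · have := ones_add_one_le h hw; omega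
  | one m hk hb' =>
    rcases le_or_gt m k with h | h
    · exact Nat.mul_le_mul_right N h
    · have := ones_add_one_le h hw; omega
  | drain m r hk hr hw' =>
    rcases lt_trichotomy m k with h | h | h
    · exact mul_add_le_of_lt h le_rfl
    · subst h; omega
    · have := ones_add_one_le h hw; omega
  | final =>
    rcases le_or_gt T k with h | h
    · exact Nat.mul_le_mul_right N h
    · have := ones_add_one_le h hw; omega

/-- A process with the bit `0` that has not been released has not released its predecessor, and
is at most one clockwise message ahead. -/
lemma Local.sent_of_not_bit {i : Fin n} {s m cs cr as ar k}
    (h : P.Local ident N T i s m cs cr as ar) (hb : P.bit (P.run ident k i) = false)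
    (hw : P.disj ident k = true) (har : ar ≤ P.ones ident k) :
    as ≤ P.ones ident k ∧ (cs ≤ k * N ∨ cs ≤ cr + 1) := by
  cases h with
  | asleep => simp
  | zero m r hk hr hb' => exact ⟨har, Or.inr le_rfl⟩
  | one m hk hb' =>
    rcases lt_trichotomy m k with h | h | h
    · exact ⟨ones_add_one_le h (disj_of_bit ident hb'), Or.inr (by omega)⟩
    · subst h; simp [hb] at hb'
    · have := ones_add_one_le h hw; omega
  | drain m r hk hr hw' =>
    rcases lt_trichotomy m k with h | h | h
    · exact ⟨har, Or.inl (mul_add_le_of_lt h le_rfl)⟩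
    · subst h; omega
    · have := ones_add_one_le h hw; omega
  | final => exact ⟨har, Or.inr (by omega)⟩

/-- If the disjunction in the round `k` is `0`, then the next counter-clockwise message is sent
after the end of this round. -/
lemma Local.received_of_lt {i : Fin n} {s m cs cr as ar k}
    (h : P.Local ident N T i s m cs cr as ar) (hw : P.disj ident k = false)
    (has : P.ones ident k < as) : k * N + N ≤ cr := by
  suffices k < m ∧ m * N ≤ cr by
    have := mul_add_le_of_lt this.1 (le_refl N); omega
  have aux : ∀ m, P.ones ident k < P.ones ident m → k < m := fun m h =>
    (ones_mono ident).reflect_lt h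
  cases h with
  | asleep => simp at has
  | zero m r hk hr hb' => exact ⟨aux _ has, by omega⟩
  | one m hk hb' =>
    have hd := disj_of_bit ident hb'
    rw [← ones_succ_of_disj ident hd] at has
    have := aux _ has
    refine ⟨lt_of_le_of_ne (by omega) ?_, by omega⟩
    rintro rfl; simp [hd] at hw
  | drain m r hk hr hd =>
    rw [← ones_succ_of_disj ident hd] at has
    have := aux _ has
    refine ⟨lt_of_le_of_ne (by omega) ?_, by omega⟩
    rintro rfl; simp [hd] at hw
  | final => exact ⟨aux _ has, le_rfl⟩

lemma local_enter (hT : P.StopsAt ident T) (hN : 0 < N) {k : ℕ} (hk : k ≤ T) (i : Fin n) :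
    P.Local ident N T i (some (P.enter N (P.run ident k i)).1) k
      (k * N + (P.enter N (P.run ident k i)).2 .cw) (k * N)
      (P.ones ident k + (P.enter N (P.run ident k i)).2 .ccw) (P.ones ident k) := by
  rcases hk.lt_or_eq with h | rfl
  · have hv := (hT i).1 k h
    by_cases hb : P.bit (P.run ident k i) = true
    · simp only [enter, hv, hb, if_true, pulses_cw, pulses_ccw]
      exact .one k h hb
    · simp only [enter, hv, hb]
      exact .zero k 0 h hN (by simpa using hb)
  · obtain ⟨v, hv⟩ := Option.ne_none_iff_exists'.1 (hT i).2
    simp only [enter, hv, pulses_cw, pulses_ccw]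
    exact .final

/-- Isolates the case analysis at one process. `h1` and `h0` are all that is needed from the rest of
the ring: they exclude a premature end of a 1-round and a premature release in a 0-round. -/
lemma Local.receive {i : Fin n} {s : P.SimState} {k cs cr as ar : ℕ} {d : Dir}
    (h : P.Local ident N T i (some s) k cs cr as ar) (hT : P.StopsAt ident T) (hN : 0 < N)
    (hv : P.verdict s.state = none) (hd : d ∈ P.listens s)
    (h1 : P.disj ident k = true → ar ≤ P.ones ident k → cs < k * N + N)
    (h0 : d = .ccw → P.disj ident k = false → cs < k * N + N → ar + 1 ≤ P.ones ident k) :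
    ∃ k', P.Local ident N T i (some (P.react s d).1) k' (cs + (P.react s d).2 .cw)
      (cr + if d = .cw then 1 else 0) (as + (P.react s d).2 .ccw)
      (ar + if d = .ccw then 1 else 0) := by
  generalize hS : some s = S at h
  cases h with
  | asleep => simp at hS
  | zero _ r hk hr hb =>
    obtain rfl := Option.some.inj hS
    cases d with
    | cw =>
      by_cases hrN : r + 1 = N
      · have hw : P.disj ident k = false := by
          by_contra hw
          have := h1 (by simpa using hw) le_rfl
          omega
        refine ⟨k + 1, ?_⟩
        have := local_enter (P := P) hT hN (k := k + 1) hk i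
        rw [run_succ, hw, ones_succ_of_not_disj ident hw, Nat.add_mul, Nat.one_mul] at this
        simpa [react, hrN, add_assoc] using this
      · refine ⟨k, ?_⟩
        have := Local.zero (P := P) (ident := ident) (N := N) (T := T) (i := i) k (r + 1) hk
          (by omega) hb
        simpa [react, hrN, add_assoc] using this
    | ccw =>
      have hrN : r + 1 < N := by simpa [listens] using hd
      have hw : P.disj ident k = true := by
        by_contra hw
        have := h0 rfl (by simpa using hw) (by omega)
        omega
      refine ⟨k, ?_⟩
      have := Local.drain (P := P) (ident := ident) (N := N) (T := T) (i := i) k r hk hr hw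
      have e : k * N + r + 1 + (N - (r + 1)) = k * N + N := by omega
      simpa [react, e] using this
  | one _ hk hb =>
    obtain rfl := Option.some.inj hS
    cases d with
    | cw => simp [listens] at hd
    | ccw =>
      refine ⟨k, ?_⟩
      have := Local.drain (P := P) (ident := ident) (N := N) (T := T) (i := i) k 0 hk hN
        (disj_of_bit ident hb)
      simpa [react] using this
  | drain _ r hk hr hw =>
    obtain rfl := Option.some.inj hS
    cases d with
    | ccw => simp [listens] at hd
    | cw =>
      by_cases hrN : r + 1 = N
      · refine ⟨k + 1, ?_⟩
        have := local_enter (P := P) hT hN (k := k + 1) hk i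
        rw [run_succ, hw, ones_succ_of_disj ident hw, Nat.add_mul, Nat.one_mul] at this
        simpa [react, hrN, add_assoc] using this
      · refine ⟨k, ?_⟩
        have := Local.drain (P := P) (ident := ident) (N := N) (T := T) (i := i) k (r + 1) hk
          (by omega) hw
        simpa [react, hrN, add_assoc] using this
  | final =>
    obtain rfl := Option.some.inj hS
    exact absurd hv (hT i).2

end OrProtocol
-- Walking around the ring
section neighbour

variable {n : ℕ} [NeZero n]

lemma neighbour_injective (d : Dir) : Function.Injective fun i : Fin n => neighbour i d := by
  cases d
  · exact add_left_injective 1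
  · exact sub_left_injective

lemma neighbour_cw_ccw (i : Fin n) : neighbour (neighbour i .ccw) .cw = i := sub_add_cancel i 1

lemma neighbour_ccw_cw (i : Fin n) : neighbour (neighbour i .cw) .ccw = i := add_sub_cancel_right i 1

/-- The strict bound `d < n` is what lets `n ≤ N` pulses per round suffice. -/
lemma exists_iterate_neighbour_cw (j i : Fin n) :
    ∃ d < n, (fun x => neighbour x .cw)^[d] j = i := by
  have hn : 0 < n := Nat.pos_of_neZero n
  have key : ∀ d : ℕ, (((fun x => neighbour x .cw)^[d] j : Fin n) : ℕ) = (j + d) % n := by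
    intro d
    induction d with
    | zero => simp [Nat.mod_eq_of_lt j.2]
    | succ d ih =>
      rw [Function.iterate_succ_apply']
      rw [show ∀ x : Fin n, neighbour x .cw = x + 1 from fun _ => rfl, Fin.val_add, ih,
        Fin.val_one', ← Nat.add_mod, add_assoc]
  rcases le_or_gt (j : ℕ) i with h | h
  · refine ⟨i - j, by omega, Fin.ext ?_⟩
    rw [key, Nat.add_sub_cancel' h, Nat.mod_eq_of_lt i.2]
  · refine ⟨n + i - j, by omega, Fin.ext ?_⟩
    rw [key, show (j : ℕ) + (n + i - j) = i + n by omega, Nat.add_mod_right, Nat.mod_eq_of_lt i.2]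

end neighbour

/-! ### The global invariant and its preservation -/

namespace OrProtocol

variable {P : OrProtocol} {n : ℕ} [NeZero n] {ident : Fin n → ℕ} {N T : ℕ}

/-- The invariant of the simulation, in a configuration in which the process `i` is in the round
`k i` and has received `g i d` messages in each direction `d`. -/
structure Inv (ident : Fin n → ℕ) (N T : ℕ) (c : Config P.algorithm n) (k : Fin n → ℕ)
    (g : Fin n → Dir → ℕ) : Prop where
  locals : ∀ i, P.Local ident N T i (c.loc i) (k i) (c.sent i .cw) (g i .cw)
    (c.sent i .ccw) (g i .ccw)
  flow : ∀ i d, c.transit (neighbour i d) d + g (neighbour i d) d = c.sent i d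

/-- The number of events that have happened. -/
def weight (c : Config P.algorithm n) (g : Fin n → Dir → ℕ) : ℕ :=
  ∑ i, ((if (c.loc i).isSome then 1 else 0) + g i .cw + g i .ccw)

section

variable {c : Config P.algorithm n} {k : Fin n → ℕ} {g : Fin n → Dir → ℕ}

lemma Inv.flow_cw (h : Inv ident N T c k g) (i : Fin n) :
    c.transit i .cw + g i .cw = c.sent (neighbour i .ccw) .cw := by
  have := h.flow (neighbour i .ccw) .cw
  rwa [neighbour_cw_ccw] at this

lemma Inv.flow_ccw (h : Inv ident N T c k g) (i : Fin n) :
    c.transit i .ccw + g i .ccw = c.sent (neighbour i .cw) .ccw := by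
  have := h.flow (neighbour i .cw) .ccw
  rwa [neighbour_ccw_cw] at this

lemma Inv.received_cw_le (h : Inv ident N T c k g) (i : Fin n) :
    g i .cw ≤ c.sent (neighbour i .ccw) .cw := h.flow_cw i ▸ Nat.le_add_left _ _

lemma Inv.received_ccw_le (h : Inv ident N T c k g) (i : Fin n) :
    g i .ccw ≤ c.sent (neighbour i .cw) .ccw := h.flow_ccw i ▸ Nat.le_add_left _ _

/-- At distance `d` from a process with the bit `1`, a process that has not been released sends at
most `d` messages in the round. -/
lemma Inv.sent_le_of_iterate (h : Inv ident N T c k g) {m : ℕ} {j : Fin n}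
    (hb : P.bit (P.run ident m j) = true) (d : ℕ) :
    g ((fun x => neighbour x .cw)^[d] j) .ccw ≤ P.ones ident m →
      c.sent ((fun x => neighbour x .cw)^[d] j) .cw ≤ m * N + d := by
  induction d with
  | zero => exact fun hg => (h.locals j).sent_of_bit hb hg
  | succ d ih =>
    rw [Function.iterate_succ_apply']
    set i := (fun x => neighbour x .cw)^[d] j
    intro hg
    by_cases hi : P.bit (P.run ident m (neighbour i .cw)) = true
    · have := (h.locals _).sent_of_bit hi hg
      omega
    -- Unreleased with bit 0, the neighbour has not forwarded a release to `i`. So `i` is unreleased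
    -- too, the induction hypothesis bounds what the neighbour received, and it is at most one pulse
    -- ahead of that.
    · have := (h.locals _).sent_of_not_bit (by simpa using hi) (disj_of_bit ident hb) hg
      have h1 := h.received_ccw_le i
      have h2 := h.received_cw_le (neighbour i .cw)
      rw [neighbour_ccw_cw] at h2
      have := ih (by omega)
      omega

lemma Inv.sent_lt (h : Inv ident N T c k g) (hN : n ≤ N) {m : ℕ}
    (hw : P.disj ident m = true) (i : Fin n) (hg : g i .ccw ≤ P.ones ident m) :
    c.sent i .cw < m * N + N := by
  obtain ⟨j, hj⟩ := of_decide_eq_true hw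
  obtain ⟨d, hd, rfl⟩ := exists_iterate_neighbour_cw j i
  have := h.sent_le_of_iterate hj d hg
  omega

/-- The clockwise neighbour would have to complete round `m` before sending its next
counter-clockwise pulse, and for that it needs all `N` clockwise pulses of the round from `i`. -/
lemma Inv.sent_ccw_le (h : Inv ident N T c k g) {m : ℕ} (hw : P.disj ident m = false) (i : Fin n)
    (hs : c.sent i .cw < m * N + N) : c.sent (neighbour i .cw) .ccw ≤ P.ones ident m := by
  by_contra! hlt
  have h1 := (h.locals _).received_of_lt hw hlt
  have h2 := h.received_cw_le (neighbour i .cw)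
  rw [neighbour_ccw_cw] at h2
  omega

/-- The process `i` acts. -/
lemma Inv.act (hl : ∀ j, P.Local ident N T j (c.loc j) (k j) (c.sent j .cw) (g j .cw)
      (c.sent j .ccw) (g j .ccw)) {c' : Config P.algorithm n} {g' : Fin n → Dir → ℕ}
    (hloc : c'.loc = c.loc) (hsent : c'.sent = c.sent)
    (hflow : ∀ j d, c'.transit (neighbour j d) d + g' (neighbour j d) d = c.sent j d)
    (i : Fin n) (hg : ∀ j ≠ i, g' j = g j) (r : P.SimState × (Dir → ℕ)) (m : ℕ)
    (hi : P.Local ident N T i (some r.1) m (c.sent i .cw + r.2 .cw) (g' i .cw)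
      (c.sent i .ccw + r.2 .ccw) (g' i .ccw)) :
    Inv ident N T (c'.act i r) (Function.update k i m) g' where
  locals j := by
    by_cases hj : j = i
    · subst hj
      simp only [Config.act, hsent, Function.update_self, if_true]
      exact hi
    · simpa [Config.act, hsent, hloc, hj, hg j hj] using hl j
  flow j d := by
    have := hflow j d
    simp only [Config.act, hsent, (neighbour_injective d).eq_iff]
    omega

lemma Inv.start (h : Inv ident N T c k g) (hT : P.StopsAt ident T) (hN : 0 < N) {i : Fin n}
    (hi : c.loc i = none) :
    ∃ k', Inv ident N T (c.act i (P.enter N (P.init (ident i)))) k' g := by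
  have h0 := h.locals i
  rw [hi] at h0
  refine ⟨_, Inv.act h.locals rfl rfl h.flow i (fun _ _ => rfl) _ 0 ?_⟩
  have := local_enter (P := P) hT hN (Nat.zero_le T) i
  generalize hs : c.sent i .cw = cs at *
  generalize c.sent i .ccw = as at *
  generalize g i .cw = cr at *
  generalize g i .ccw = ar at *
  generalize k i = m at *
  cases h0
  simpa [ones, run] using this

lemma Inv.receive (h : Inv ident N T c k g) (hT : P.StopsAt ident T) (hN : n ≤ N) {i : Fin n}
    {d : Dir} {s : P.SimState} (hi : c.loc i = some s) (hv : P.verdict s.state = none)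
    (hd : d ∈ P.listens s) (ht : 0 < c.transit i d) :
    ∃ k', Inv ident N T ((c.consume i d).act i (P.react s d)) k'
      (fun j e => g j e + if j = i ∧ e = d then 1 else 0) := by
  have hn : 0 < n := Nat.pos_of_neZero n
  have hl := h.locals i
  rw [hi] at hl
  obtain ⟨m, hm⟩ := hl.receive hT (by omega) hv hd (fun hw hg => h.sent_lt hN hw i hg) (by
    rintro rfl hw hs
    have h1 := h.sent_ccw_le hw i hs
    have h2 := h.flow_ccw i
    omega)
  refine ⟨_, Inv.act (c := c) (c' := c.consume i d)
    (g' := fun j e => g j e + if j = i ∧ e = d then 1 else 0) h.locals rfl rfl ?_ i ?_ _ m ?_⟩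
  · intro j e
    have := h.flow j e
    by_cases hj : neighbour j e = i ∧ e = d
    · obtain ⟨rfl, rfl⟩ := hj
      simp only [Config.consume, and_self, if_true]
      omega
    · simpa [Config.consume, hj] using this
  · intro j hj
    simp [hj]
  · simpa [eq_comm] using hm

lemma weight_start {i : Fin n} (hi : c.loc i = none) (r : P.SimState × (Dir → ℕ)) :
    weight (c.act i r) g = weight c g + 1 := by
  have : ∀ j, (if ((c.act i r).loc j).isSome then 1 else 0) + g j .cw + g j .ccw
      = ((if (c.loc j).isSome then 1 else 0) + g j .cw + g j .ccw) + if j = i then 1 else 0 := by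
    intro j
    by_cases hj : j = i
    · subst hj; simp [Config.act, hi]; omega
    · simp [Config.act, hj]
  simp [weight, this, Finset.sum_add_distrib]

lemma weight_receive {i : Fin n} {d : Dir} {s : P.SimState} (hi : c.loc i = some s)
    (r : P.SimState × (Dir → ℕ)) :
    weight ((c.consume i d).act i r) (fun j e => g j e + if j = i ∧ e = d then 1 else 0)
      = weight c g + 1 := by
  have : ∀ j, (if (((c.consume i d).act i r).loc j).isSome then 1 else 0)
        + (g j .cw + if j = i ∧ Dir.cw = d then 1 else 0)
        + (g j .ccw + if j = i ∧ Dir.ccw = d then 1 else 0)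
      = ((if (c.loc j).isSome then 1 else 0) + g j .cw + g j .ccw) + if j = i then 1 else 0 := by
    intro j
    by_cases hj : j = i
    · subst hj
      have h1 : (c.loc j).isSome = true := by rw [hi]; rfl
      have h2 : (((c.consume j d).act j r).loc j).isSome = true := by simp [Config.act]
      rw [h1, h2]
      cases d <;> simp <;> omega
    · simp [Config.act, Config.consume, hj]
  simp [weight, this, Finset.sum_add_distrib]

lemma Inv.step (h : Inv ident N T c k g) (hT : P.StopsAt ident T) (hN : n ≤ N) {a : Event n}
    {c' : Config P.algorithm n} (hs : Step N ident c a c') :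
    ∃ k' g', Inv ident N T c' k' g' ∧ weight c' g' = weight c g + 1 := by
  cases hs with
  | start i hi =>
    obtain ⟨k', hk⟩ := h.start hT ((Nat.pos_of_neZero n).trans_le hN) hi
    exact ⟨k', g, hk, weight_start hi _⟩
  | receive i d s D hi hm hd ht =>
    obtain ⟨hv, rfl⟩ : P.verdict s.state = none ∧ D = P.listens s := by
      simp only [algorithm] at hm
      split at hm
      · simp at hm
      · next h => exact ⟨h, by simpa [eq_comm] using hm⟩
    obtain ⟨k', hk⟩ := h.receive hT hN hi hv hd ht
    exact ⟨k', _, hk, weight_receive hi _⟩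

lemma Inv.weight_le (h : Inv ident N T c k g) :
    weight c g ≤ n * (1 + T * N + P.ones ident T) := by
  have : ∀ i ∈ Finset.univ, (if (c.loc i).isSome then 1 else 0) + g i .cw + g i .ccw
      ≤ 1 + T * N + P.ones ident T := by
    intro i _
    have h1 := (h.locals i).cw_le
    have h2 := (h.locals i).ccw_le
    split_ifs <;> omega
  simpa [weight] using Finset.sum_le_card_nsmul _ _ _ this

end

lemma inv_initial : Inv ident N T (Config.initial P.algorithm n) (fun _ => 0) (fun _ _ => 0) where
  locals _ := .asleep
  flow _ _ := rfl

lemma exists_inv (hT : P.StopsAt ident T) (hN : n ≤ N) {c : ℕ → Config P.algorithm n}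
    {e : ℕ → Option (Event n)} (hc : IsExecution N ident c e) (t : ℕ) :
    ∃ k g, Inv ident N T (c t) k g ∧
      weight (c t) g = ((Finset.range t).filter fun s => (e s).isSome).card := by
  induction t with
  | zero => exact ⟨_, _, hc.initial ▸ inv_initial, by simp [hc.initial, weight, Config.initial]⟩
  | succ t ih =>
    obtain ⟨k, g, h, hw⟩ := ih
    rw [Finset.range_add_one, Finset.filter_insert]
    cases he : e t with
    | none =>
      rw [hc.idle t he]
      exact ⟨k, g, h, by simpa using hw⟩
    | some a =>
      obtain ⟨k', g', h', hw'⟩ := h.step hT hN (hc.step t a he)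
      exact ⟨k', g', h', by simp [hw', hw]⟩

end OrProtocol

/-! ### Termination and quiescence -/

namespace OrProtocol

variable {P : OrProtocol} {n : ℕ} {ident : Fin n → ℕ} {N T : ℕ}

lemma Local.stage_of_not_disj {i : Fin n} {s k cs cr as ar m}
    (h : P.Local ident N T i s k cs cr as ar) (hs : s ≠ none) (hmk : m ≤ k) (hm : m < T)
    (hw : P.disj ident m = false) :
    (m < k ∧ m * N + N ≤ cs ∧ m * N + N ≤ cr) ∨
      ∃ r, s = some ⟨N, P.run ident m i, .zero, r⟩ ∧ cr < m * N + N ∧ cs = cr + 1 := by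
  rcases hmk.lt_or_eq with hlt | rfl
  · have := mul_add_le_of_lt hlt (le_refl N)
    left
    cases h <;> omega
  · cases h with
    | asleep => exact absurd rfl hs
    | zero _ r hk hr hb => exact Or.inr ⟨r, rfl, by omega, rfl⟩
    | one _ hk hb => simp [disj_of_bit ident hb] at hw
    | drain _ r hk hr hd => simp [hd] at hw
    | final => omega

/-- The dichotomy is released versus unreleased in round `m`; it is applied with `m` the least
current round. -/
lemma Local.stage_of_disj {i : Fin n} {s k cs cr as ar m}
    (h : P.Local ident N T i s k cs cr as ar) (hs : s ≠ none) (hmk : m ≤ k) (hm : m < T)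
    (hw : P.disj ident m = true) :
    (m * N + N ≤ cs ∧ P.ones ident m + 1 ≤ as ∧
      (m < k ∨ ∃ r, s = some ⟨N, P.run ident m i, .drain, r⟩ ∧ cr < m * N + N)) ∨
    (ar = P.ones ident m ∧
      ((as = P.ones ident m ∧ P.bit (P.run ident m i) = false ∧
        ∃ r, s = some ⟨N, P.run ident m i, .zero, r⟩ ∧ cs = m * N + r + 1) ∨
      (as = P.ones ident m + 1 ∧ s = some ⟨N, P.run ident m i, .one, 0⟩))) := by
  rcases hmk.lt_or_eq with hlt | rfl
  · have h1 := mul_add_le_of_lt hlt (le_refl N)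
    have h2 := ones_add_one_le hlt hw
    left
    cases h <;> first | exact absurd rfl hs | exact ⟨by omega, by omega, Or.inl hlt⟩
  · cases h with
    | asleep => exact absurd rfl hs
    | zero _ r hk hr hb => exact Or.inr ⟨rfl, Or.inl ⟨rfl, hb, r, rfl, rfl⟩⟩
    | one _ hk hb => exact Or.inr ⟨rfl, Or.inr ⟨rfl, rfl⟩⟩
    | drain _ r hk hr hd => exact Or.inl ⟨le_rfl, le_rfl, Or.inr ⟨r, rfl, by omega⟩⟩
    | final => omega

lemma Local.eq_final {i : Fin n} {s k cs cr as ar}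
    (h : P.Local ident N T i s k cs cr as ar) (hT : P.StopsAt ident T) {s' : P.SimState}
    (hs : s = some s') (hv : k = T ∨ P.verdict s'.state ≠ none) :
    s'.state = P.run ident T i ∧ cs = T * N ∧ cr = T * N ∧ as = P.ones ident T ∧
      ar = P.ones ident T := by
  have hrun : ∀ m, m < T → ¬ (m = T ∨ P.verdict (P.run ident m i) ≠ none) := by
    rintro m hm (h | h)
    · omega
    · exact h ((hT i).1 m hm)
  cases h with
  | asleep => simp at hs
  | final => obtain rfl := Option.some.inj hs; exact ⟨rfl, rfl, rfl, rfl, rfl⟩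
  | zero _ r hk => obtain rfl := Option.some.inj hs; exact absurd hv (hrun _ hk)
  | one _ hk => obtain rfl := Option.some.inj hs; exact absurd hv (hrun _ hk)
  | drain _ r hk => obtain rfl := Option.some.inj hs; exact absurd hv (hrun _ hk)

lemma verdict_of_loc {c : Config P.algorithm n} {i : Fin n} {s : P.SimState}
    (hi : c.loc i = some s) : c.verdict i = P.verdict s.state := by
  simp only [Config.verdict, hi, algorithm]
  cases P.verdict s.state <;> rfl

lemma exists_loc_of_verdict {c : Config P.algorithm n} {i : Fin n} {v : Verdict}
    (hi : c.verdict i = some v) :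
    ∃ s : P.SimState, c.loc i = some s ∧ P.verdict s.state = some v := by
  cases hs : c.loc i with
  | none => simp [Config.verdict, hs] at hi
  | some s => exact ⟨s, rfl, by rw [← hi, verdict_of_loc hs]⟩

variable [NeZero n]

section

variable {c : Config P.algorithm n} {k : Fin n → ℕ} {g : Fin n → Dir → ℕ}

lemma transit_eq_zero_of_blocked (hblock : ∀ a c', ¬ Step N ident c a c') {i : Fin n}
    {s : P.SimState} (hi : c.loc i = some s) (hv : P.verdict s.state = none) {d : Dir}
    (hd : d ∈ P.listens s) : c.transit i d = 0 := by
  by_contra hne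
  refine hblock _ _ (Step.receive i d s (P.listens s) hi ?_ hd (Nat.pos_of_ne_zero hne))
  simp only [algorithm, hv]

/-- A configuration in which no event can happen is terminated. -/
lemma Inv.terminated_of_blocked (h : Inv ident N T c k g) (hT : P.StopsAt ident T) (hN : n ≤ N)
    (hblock : ∀ a c', ¬ Step N ident c a c') : c.Terminated := by
  have hsome : ∀ i, c.loc i ≠ none := fun i hi => hblock _ _ (Step.start i hi)
  obtain ⟨i₀, hmin⟩ := Finite.exists_min k
  rcases (h.locals i₀).round_le.lt_or_eq with hm | hm
  swap
  · intro i
    obtain ⟨s, hs⟩ := Option.ne_none_iff_exists'.1 (hsome i)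
    have hk : k i = T := le_antisymm (h.locals i).round_le (hm ▸ hmin i)
    have hf := (h.locals i).eq_final hT hs (Or.inl hk)
    rw [verdict_of_loc hs, hf.1]
    exact Option.ne_none_iff_exists'.1 (hT i).2
  exfalso
  obtain ⟨m, hkm⟩ : ∃ m, m = k i₀ := ⟨_, rfl⟩
  rw [← hkm] at hm
  have hmin' : ∀ i, m ≤ k i := fun i => hkm ▸ hmin i
  cases hw : P.disj ident m with
  | false =>
    have hst := fun i => (h.locals i).stage_of_not_disj (hsome i) (hmin' i) hm hw
    -- All-zero round: the process that has received least is one pulse ahead of its receipts, and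
    -- its predecessor has sent still more than that process received, so a pulse is waiting.
    obtain ⟨i, hi⟩ := Finite.exists_min fun i => g i .cw
    have hlt : g i .cw < m * N + N := by
      rcases hst i₀ with h0 | ⟨r, _, h0, _⟩
      · omega
      · exact (hi i₀).trans_lt h0
    rcases hst i with h0 | ⟨r, hs, h0, h1⟩
    · omega
    have ht := transit_eq_zero_of_blocked hblock hs ((hT i).1 m hm) (d := .cw) (Or.inl rfl)
    have hf := h.flow_cw i
    have := hi (neighbour i .ccw)
    rcases hst (neighbour i .ccw) with h2 | ⟨_, _, _, h2⟩ <;> omega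
  | true =>
    have hst := fun i => (h.locals i).stage_of_disj (hsome i) (hmin' i) hm hw
    -- Some process is unreleased: otherwise all have sent their full quota, and the slowest process
    -- `i₀`, still draining, has a pulse waiting.
    obtain ⟨i, hi⟩ : ∃ i, g i .ccw = P.ones ident m ∧ c.sent i .cw < m * N + N := by
      suffices ∃ i, ¬ m * N + N ≤ c.sent i .cw by
        obtain ⟨i, hi⟩ := this
        rcases hst i with h0 | h0
        · omega
        · exact ⟨i, h0.1, by omega⟩
      rcases hst i₀ with ⟨_, _, h0 | ⟨r, hs, h0⟩⟩ | ⟨h0, _⟩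
      · omega
      · have ht := transit_eq_zero_of_blocked hblock hs ((hT i₀).1 m hm) (d := .cw) rfl
        have hf := h.flow_cw i₀
        exact ⟨neighbour i₀ .ccw, by omega⟩
      · exact ⟨i₀, by have := h.sent_lt hN hw i₀ h0.le; omega⟩
    -- An unreleased process with no release waiting has a clockwise neighbour that is itself
    -- unreleased and has bit 0. Going around the ring, every bit is 0, against the disjunction
    -- being 1.
    have hnext : ∀ i, g i .ccw = P.ones ident m → c.sent i .cw < m * N + N →
        P.bit (P.run ident m (neighbour i .cw)) = false ∧
        g (neighbour i .cw) .ccw = P.ones ident m ∧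
        c.sent (neighbour i .cw) .cw < m * N + N := by
      intro i hg hlt
      have ht : c.transit i .ccw = 0 := by
        rcases hst i with h0 | ⟨_, ⟨_, _, r, hs, hr⟩ | ⟨_, hs⟩⟩
        · omega
        · refine transit_eq_zero_of_blocked hblock hs ((hT i).1 m hm) (Or.inr ?_)
          show r + 1 < N
          omega
        · exact transit_eq_zero_of_blocked hblock hs ((hT i).1 m hm) rfl
      have hf := h.flow_ccw i
      rcases hst (neighbour i .cw) with h0 | ⟨h0, ⟨_, hb, _⟩ | ⟨h1, _⟩⟩
      · omega
      · exact ⟨hb, h0, h.sent_lt hN hw _ h0.le⟩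
      · omega
    have hall : ∀ d, P.bit (P.run ident m ((fun x => neighbour x .cw)^[d] (neighbour i .cw)))
          = false ∧
        g ((fun x => neighbour x .cw)^[d] (neighbour i .cw)) .ccw = P.ones ident m ∧
        c.sent ((fun x => neighbour x .cw)^[d] (neighbour i .cw)) .cw < m * N + N := by
      intro d
      induction d with
      | zero => exact hnext i hi.1 hi.2
      | succ d ih =>
        rw [Function.iterate_succ_apply']
        exact hnext _ ih.2.1 ih.2.2
    obtain ⟨j, hj⟩ := of_decide_eq_true hw
    obtain ⟨d, -, rfl⟩ := exists_iterate_neighbour_cw (neighbour i .cw) j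
    simp [(hall d).1] at hj

lemma Inv.final_of_terminated (h : Inv ident N T c k g) (hT : P.StopsAt ident T)
    (hc : c.Terminated) :
    (∀ i, c.verdict i = P.verdict (P.run ident T i)) ∧ ∀ i d, c.transit i d = 0 := by
  have hf : ∀ i, c.verdict i = P.verdict (P.run ident T i) ∧ c.sent i .cw = T * N ∧
      g i .cw = T * N ∧ c.sent i .ccw = P.ones ident T ∧ g i .ccw = P.ones ident T := by
    intro i
    obtain ⟨v, hv⟩ := hc i
    obtain ⟨s, hs, hsv⟩ := exists_loc_of_verdict hv
    have := (h.locals i).eq_final hT hs (Or.inr (by simp [hsv]))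
    exact ⟨by rw [verdict_of_loc hs, this.1], this.2⟩
  refine ⟨fun i => (hf i).1, fun i d => ?_⟩
  cases d
  · have := h.flow_cw i
    have := hf i
    have := hf (neighbour i .ccw)
    omega
  · have := h.flow_ccw i
    have := hf i
    have := hf (neighbour i .cw)
    omega

end

lemma exists_forall_eq_none {α : Type*} {e : ℕ → Option α} {B : ℕ}
    (hB : ∀ t, ((Finset.range t).filter fun s => (e s).isSome).card ≤ B) :
    ∃ t, ∀ s ≥ t, e s = none := by
  have hfin : {s | (e s).isSome}.Finite := by
    by_contra hinf
    obtain ⟨F, hF, hcard⟩ := Set.Infinite.exists_subset_card_eq hinf (B + 1)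
    have hsub : F ⊆ (Finset.range (F.sup id + 1)).filter fun s => (e s).isSome := by
      intro s hs
      have := Finset.le_sup (f := id) hs
      simp only [Finset.mem_filter, Finset.mem_range]
      exact ⟨Nat.lt_succ_of_le this, hF hs⟩
    have := (Finset.card_le_card hsub).trans (hB _)
    omega
  obtain ⟨b, hb⟩ := hfin.bddAbove
  refine ⟨b + 1, fun s hs => ?_⟩
  by_contra hne
  have : s ≤ b := hb (Option.isSome_iff_ne_none.2 hne)
  omega

variable {c : ℕ → Config P.algorithm n} {e : ℕ → Option (Event n)}

/-- Each event raises the bounded `weight`, so the execution is eventually constant; by fairness no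
event is then possible. -/
theorem exists_terminated (hT : P.StopsAt ident T) (hN : n ≤ N) (hc : IsExecution N ident c e) :
    ∃ t, (c t).Terminated := by
  obtain ⟨t, ht⟩ := exists_forall_eq_none (e := e) (B := n * (1 + T * N + P.ones ident T)) (by
    intro t
    obtain ⟨k, g, h, hw⟩ := exists_inv hT hN hc t
    exact hw ▸ h.weight_le)
  have hconst : ∀ s ≥ t, c s = c t := by
    intro s hs
    induction s, hs using Nat.le_induction with
    | base => rfl
    | succ s hs ih => rw [hc.idle s (ht s hs), ih]
  obtain ⟨k, g, h, -⟩ := exists_inv hT hN hc t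
  refine ⟨t, h.terminated_of_blocked hT hN fun a c' hs => ?_⟩
  obtain ⟨s, hst, hs'⟩ := hc.fair a t fun s hst => ⟨c', by rwa [hconst s hst]⟩
  simp [ht s hst] at hs'

theorem final_of_terminated (hT : P.StopsAt ident T) (hN : n ≤ N) (hc : IsExecution N ident c e)
    {t : ℕ} (ht : (c t).Terminated) :
    (∀ i, (c t).verdict i = P.verdict (P.run ident T i)) ∧ ∀ i d, (c t).transit i d = 0 := by
  obtain ⟨k, g, h, -⟩ := exists_inv hT hN hc t
  exact h.final_of_terminated hT ht

theorem sent_le (hT : P.StopsAt ident T) (hN : n ≤ N) (hc : IsExecution N ident c e) (t : ℕ)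
    (i : Fin n) : (c t).sent i .cw ≤ T * N ∧ (c t).sent i .ccw ≤ T := by
  obtain ⟨k, g, h, -⟩ := exists_inv hT hN hc t
  exact ⟨(h.locals i).cw_le.1, (h.locals i).ccw_le.1.trans (ones_le ident T)⟩

end OrProtocol
-- Election by comparing codes
/-- The `m`-th bit of the code of `x`: as many zeros as `x` has binary digits, then a one, then
the binary digits of `x`. -/
def codeBit (x m : ℕ) : Bool :=
  decide (m = x.size) || (decide (x.size < m) && x.testBit (m - x.size - 1))

/-- The local state of the election: the identifier, the number of the round, the first round with
the disjunction `1`, and whether the process is still a candidate. -/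
structure ElectionState where
  ident : ℕ
  round : ℕ
  first : Option ℕ
  alive : Bool

/-- The election of the process with the lexicographically largest code: every candidate contributes
the next bit of its code, and drops out if its bit is not the disjunction. -/
def election : OrProtocol where
  State := ElectionState
  init x := ⟨x, 0, none, true⟩
  bit p := p.alive && codeBit p.ident p.round
  next p b := ⟨p.ident, p.round + 1, if p.first = none ∧ b = true then some p.round else p.first,
    p.alive && (b == codeBit p.ident p.round)⟩
  verdict p := match p.first with
    | none => none
    | some L =>
      -- A code of size `L` consists of `L` zeros, a one and `L` digits.
      if p.round = 2 * L + 1 then some (if p.alive then .leader else .nonLeader) else none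

namespace election

variable {n : ℕ} (ident : Fin n → ℕ)

/-- Whether the process `i` is a candidate in the round `k`. -/
def candidate : ℕ → Fin n → Bool
  | 0, _ => true
  | k + 1, i => candidate k i &&
      (decide (∃ j, (candidate k j && codeBit (ident j) k) = true) == codeBit (ident i) k)

lemma candidate_succ_iff (k : ℕ) (i : Fin n) :
    candidate ident (k + 1) i = true ↔ candidate ident k i = true ∧
      ((∃ j, candidate ident k j = true ∧ codeBit (ident j) k = true) ↔
        codeBit (ident i) k = true) := by
  simp only [candidate, Bool.and_eq_true, beq_iff_eq]
  refine and_congr_right fun _ => ?_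
  rw [Bool.eq_iff_iff]
  simp

/-- A candidate witnessing a disjunction 1 survives; if the disjunction is 0, all candidates do. -/
lemma exists_candidate [NeZero n] (k : ℕ) : ∃ i, candidate ident k i = true := by
  induction k with
  | zero => exact ⟨0, rfl⟩
  | succ k ih =>
    simp only [candidate_succ_iff]
    by_cases h : ∃ j, candidate ident k j = true ∧ codeBit (ident j) k = true
    · obtain ⟨j, hj⟩ := h
      exact ⟨j, hj.1, iff_of_true ⟨j, hj⟩ hj.2⟩
    · obtain ⟨i, hi⟩ := ih
      exact ⟨i, hi, iff_of_false h fun hc => h ⟨i, hi, hc⟩⟩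

lemma codeBit_eq_of_candidate {k m : ℕ} (hm : m < k) {i j : Fin n}
    (hi : candidate ident k i = true) (hj : candidate ident k j = true) :
    codeBit (ident i) m = codeBit (ident j) m := by
  induction k with
  | zero => omega
  | succ k ih =>
    rw [candidate_succ_iff] at hi hj
    rcases (Nat.lt_succ_iff_lt_or_eq.1 hm) with h | rfl
    · exact ih h hi.1 hj.1
    · rw [Bool.eq_iff_iff, ← hi.2, ← hj.2]

variable {ident} {L : ℕ} (hL : ∀ i, L ≤ (ident i).size)
include hL

lemma codeBit_of_lt {k : ℕ} (hk : k < L) (i : Fin n) : codeBit (ident i) k = false := by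
  have := hL i
  simp only [codeBit, Bool.or_eq_false_iff, Bool.and_eq_false_iff, decide_eq_false_iff_not]
  exact ⟨by omega, Or.inl (by omega)⟩

lemma candidate_of_le {k : ℕ} (hk : k ≤ L) (i : Fin n) : candidate ident k i = true := by
  induction k generalizing i with
  | zero => rfl
  | succ k ih =>
    simp [candidate_succ_iff, ih (by omega), codeBit_of_lt hL hk]

lemma codeBit_self (i : Fin n) : codeBit (ident i) L = true ↔ (ident i).size = L := by
  have := hL i
  simp only [codeBit, Bool.or_eq_true, Bool.and_eq_true, decide_eq_true_eq]
  constructor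
  · rintro (h | h) <;> omega
  · exact fun h => Or.inl h.symm

/-- In round `L` everyone is still a candidate and only codes of size `L` show a one, so longer ones
drop out. -/
lemma size_of_candidate (hex : ∃ i, (ident i).size = L) {i : Fin n} {k : ℕ} (hk : L < k)
    (hi : candidate ident k i = true) : (ident i).size = L := by
  induction k with
  | zero => omega
  | succ k ih =>
    rw [candidate_succ_iff] at hi
    rcases Nat.lt_succ_iff_lt_or_eq.1 hk with h | rfl
    · exact ih h hi.1
    · obtain ⟨j, hj⟩ := hex
      exact (codeBit_self hL i).1
        (hi.2.1 ⟨j, candidate_of_le hL le_rfl j, (codeBit_self hL j).2 hj⟩)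

lemma existsUnique_candidate [NeZero n] (hident : Function.Injective ident)
    (hex : ∃ i, (ident i).size = L) : ∃! i, candidate ident (2 * L + 1) i = true := by
  obtain ⟨i, hi⟩ := exists_candidate ident (2 * L + 1)
  refine ⟨i, hi, fun j hj => hident (Nat.eq_of_testBit_eq fun m => ?_)⟩
  have hsi := size_of_candidate hL hex (by omega) hi
  have hsj := size_of_candidate hL hex (by omega) hj
  rcases lt_or_ge m L with h | h
  -- Digit `m` is compared in round `m + L + 1`, after the zeros and the one.
  · have := codeBit_eq_of_candidate ident (m := m + L + 1) (by omega) hi hj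
    have e1 : m + L + 1 ≠ L := by omega
    have e2 : L < m + L + 1 := by omega
    have e3 : m + L + 1 - L - 1 = m := by omega
    simpa [codeBit, hsi, hsj, e1, e2, e3] using this.symm
  · have hlt : ∀ x : ℕ, x.size = L → x.testBit m = false := fun x hx =>
      Nat.testBit_lt_two_pow ((Nat.size_le.1 hx.le).trans_le (Nat.pow_le_pow_right two_pos h))
    rw [hlt _ hsi, hlt _ hsj]

lemma run_eq (hex : ∃ i, (ident i).size = L) (k : ℕ) (i : Fin n) :
    election.run ident k i =
      ⟨ident i, k, if L < k then some L else none, candidate ident k i⟩ := by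
  induction k generalizing i with
  | zero => rfl
  | succ k ih =>
    rw [OrProtocol.run]
    simp only [ih]
    simp only [election, candidate]
    congr 1
    have hiff : (∃ j, (candidate ident k j && codeBit (ident j) k) = true) ↔
        ∃ j, candidate ident k j = true ∧ codeBit (ident j) k = true := by simp
    simp only [decide_eq_true_eq, hiff]
    rcases lt_trichotomy k L with h | rfl | h
    · have h1 : ¬ L < k := by omega
      have h2 : ¬ L < k + 1 := by omega
      simp [h1, h2, codeBit_of_lt hL h]
    · obtain ⟨j, hj⟩ := hex
      have : ∃ j, candidate ident k j = true ∧ codeBit (ident j) k = true :=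
        ⟨j, candidate_of_le hL le_rfl j, (codeBit_self hL j).2 hj⟩
      simp [this]
    · have h2 : L < k + 1 := by omega
      simp [h, h2]

lemma verdict_run (hex : ∃ i, (ident i).size = L) (k : ℕ) (i : Fin n) :
    election.verdict (election.run ident k i) =
      if k = 2 * L + 1 then
        some (if candidate ident k i = true then .leader else .nonLeader) else none := by
  rw [run_eq hL hex]
  by_cases h : L < k
  · simp [election, h]
  · have : k ≠ 2 * L + 1 := by omega
    simp [election, h, this]

lemma stopsAt (hex : ∃ i, (ident i).size = L) : election.StopsAt ident (2 * L + 1) := by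
  intro i
  simp only [verdict_run hL hex]
  exact ⟨fun k hk => if_neg hk.ne, by simp⟩

end election

/-! ### Correctness of the election and message bounds -/

lemma size_le_log_add_one (x : ℕ) : x.size ≤ Nat.log 2 x + 1 :=
  Nat.size_le.2 (Nat.lt_pow_succ_log_self one_lt_two x)

lemma exists_isLeast_range {n : ℕ} [NeZero n] (ident : Fin n → ℕ) :
    ∃ x, IsLeast (Set.range ident) x := by
  obtain ⟨i, hi⟩ := Finite.exists_min ident
  exact ⟨ident i, ⟨i, rfl⟩, by rintro _ ⟨j, rfl⟩; exact hi j⟩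

lemma size_of_isLeast {n : ℕ} {ident : Fin n → ℕ} {x : ℕ} (hx : IsLeast (Set.range ident) x) :
    (∀ i, x.size ≤ (ident i).size) ∧ ∃ i, (ident i).size = x.size := by
  obtain ⟨⟨i, hi⟩, hle⟩ := hx
  exact ⟨fun j => Nat.size_le_size (hle ⟨j, rfl⟩), i, by rw [hi]⟩

theorem isQuiescentLeaderElection_election : IsQuiescentLeaderElection election.algorithm := by
  intro U n _ hU ident hident c e hc
  obtain ⟨x, hx⟩ := exists_isLeast_range ident
  obtain ⟨hL, hex⟩ := size_of_isLeast hx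
  have hT := election.stopsAt hL hex
  refine ⟨OrProtocol.exists_terminated hT hU hc, fun t ht => ?_⟩
  obtain ⟨hv, htr⟩ := OrProtocol.final_of_terminated hT hU hc ht
  refine ⟨?_, htr⟩
  have hlead : ∀ i, (c t).verdict i = some .leader ↔
      election.candidate ident (2 * x.size + 1) i = true := by
    intro i
    rw [hv, election.verdict_run hL hex, if_pos rfl]
    by_cases h : election.candidate ident (2 * x.size + 1) i = true <;> simp [h]
  simpa only [hlead] using election.existsUnique_candidate hL hident hex

end PulseRing

theorem theorem3 :
    ∃ A : PulseRing.Algorithm, PulseRing.IsQuiescentLeaderElection A ∧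
      ∃ C : ℕ, ∀ (U n : ℕ) [NeZero n], n ≤ U →
        ∀ ident : Fin n → ℕ, Function.Injective ident →
        ∀ idMin : ℕ, IsLeast (Set.range ident) idMin →
        ∀ (c : ℕ → PulseRing.Config A n) (e : ℕ → Option (PulseRing.Event n)),
          PulseRing.IsExecution U ident c e → ∀ t : ℕ,
            (∀ i, (c t).sent i .cw ≤ C * (U * (Nat.log 2 idMin + 1))) ∧
            (∀ i, (c t).sent i .ccw ≤ C * (Nat.log 2 idMin + 1)) ∧
            ∑ i, ((c t).sent i .cw + (c t).sent i .ccw)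
              ≤ C * (n * U * (Nat.log 2 idMin + 1)) := by
  -- With `l = Nat.log 2 idMin + 1` there are at most `3 * l` rounds, so each process sends at most
  -- `3 * U * l` clockwise and `3 * l` counter-clockwise pulses; 6 covers their sum since `1 ≤ U`.
  refine ⟨PulseRing.election.algorithm, PulseRing.isQuiescentLeaderElection_election, 6, ?_⟩
  intro U n _ hU ident _ idMin hmin c e hc t
  obtain ⟨hL, hex⟩ := PulseRing.size_of_isLeast hmin
  have hs := PulseRing.size_le_log_add_one idMin
  have hl : 0 < Nat.log 2 idMin + 1 := Nat.succ_pos _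
  have hsent := PulseRing.OrProtocol.sent_le (PulseRing.election.stopsAt hL hex) hU hc t
  have hU1 : 1 ≤ U := (Nat.pos_of_neZero n).trans_le hU
  generalize Nat.log 2 idMin + 1 = l at *
  have hT : 2 * idMin.size + 1 ≤ 3 * l := by
    omega
  have hcw : ∀ i, (c t).sent i .cw ≤ 3 * (U * l) := fun i =>
    (hsent i).1.trans ((Nat.mul_le_mul_right U hT).trans_eq (by ring))
  have hccw : ∀ i, (c t).sent i .ccw ≤ 3 * l := fun i => (hsent i).2.trans hT
  refine ⟨fun i => (hcw i).trans (by omega), fun i => (hccw i).trans (by omega), ?_⟩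
  have hsum : ∀ i ∈ Finset.univ, (c t).sent i .cw + (c t).sent i .ccw ≤ 6 * (U * l) := by
    intro i _
    have := hcw i
    have := hccw i
    have := Nat.le_mul_of_pos_left l hU1
    omega
  refine (Finset.sum_le_card_nsmul _ _ _ hsum).trans_eq ?_
  simp only [Finset.card_univ, Fintype.card_fin, smul_eq_mul]
  ring
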